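/- For integers $n, k \ge 1$ let $S_{n,k} = \{(i+1,\, i+j) : 0 \le i \le n-1,\ 1 \le j \le k\} \subseteq \mathbb{Z}^2$ (matrix coordinates: row, column) be the shape formed by $n$ consecutive rows of $k$ cells each, every row being shifted one column to the right relative to the row above it. A standard Young tableau of shape $S_{n,k}$ is a bijective filling of the cells of $S_{n,k}$ with the integers $1, \dots, nk$ that increases from left to right along rows and from top to bottom along columns. Let $T(n,k)$ be the number of standard Young tableaux of shape $S_{n,k}$. Then for all $n \ge 76$, $$T(n,6) = 120\,T(n-1,6) - 1672\,T(n-2,6) + 544\,T(n-3,6) - 6672\,T(n-4,6) + 256\,T(n-5,6).$$ -/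

import Mathlib

/-- The index of the top row of a finite set of cells. A cell is a pair `(row, column)` in matrix
coordinates: row indices increase downwards, so the top row has the smallest index. -/
noncomputable def topRow (P : Finset (ℤ × ℤ)) : ℤ :=
  sInf {i : ℤ | ∃ j : ℤ, (i, j) ∈ P}

/-- The index of the bottom row of a finite set of cells. -/
noncomputable def bottomRow (P : Finset (ℤ × ℤ)) : ℤ :=
  sSup {i : ℤ | ∃ j : ℤ, (i, j) ∈ P}

/-- The left-most cell of `P` in row `i` (for a row that meets `P`). -/
noncomputable def leftmostCell (P : Finset (ℤ × ℤ)) (i : ℤ) : ℤ × ℤ :=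
  (i, sInf {j : ℤ | (i, j) ∈ P})

/-- The shift vector `b - a + (1, w)`, where `a` is the left-most cell in the top row and `b` is
the left-most cell in the bottom row of `P`. -/
noncomputable def shiftVector (P : Finset (ℤ × ℤ)) (w : ℕ) : ℤ × ℤ :=
  leftmostCell P (bottomRow P) - leftmostCell P (topRow P) + (1, (w : ℤ))

/-- The shape with period `P`, shift number `w` and `m` periods: the union of the translates
`i • shiftVector P w + P` for `i = 0, …, m - 1`. -/
noncomputable def Sh (w : ℕ) (P : Finset (ℤ × ℤ)) (m : ℕ) : Finset (ℤ × ℤ) :=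
  (Finset.range m).biUnion fun i => P.image fun u => i • shiftVector P w + u

/-- Standard Young tableaux of shape `S`: injective fillings of the cells of `S` by the numbers
`1, …, |S|` that increase from left to right between horizontally adjacent cells of `S` and from
top to bottom between vertically adjacent cells of `S`. -/
structure SYT (S : Finset (ℤ × ℤ)) where
  entry : {u : ℤ × ℤ // u ∈ S} → ℕ
  injective : Function.Injective entry
  mem_Icc : ∀ u, entry u ∈ Finset.Icc 1 S.card
  row_lt : ∀ (i j : ℤ) (h : (i, j) ∈ S) (h' : (i, j + 1) ∈ S), entry ⟨(i, j), h⟩ < entry ⟨(i, j + 1), h'⟩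
  col_lt : ∀ (i j : ℤ) (h : (i, j) ∈ S) (h' : (i + 1, j) ∈ S), entry ⟨(i, j), h⟩ < entry ⟨(i + 1, j), h'⟩

/-- The single row with the `k` cells `(1, 1), …, (1, k)`. -/
noncomputable def singleRow (k : ℕ) : Finset (ℤ × ℤ) :=
  (Finset.Icc (1 : ℤ) (k : ℤ)).image fun j => ((1 : ℤ), j)

/-- The number of standard Young tableaux with `n` rows of `k` cells and shift number `1`. -/
noncomputable def T (n k : ℕ) : ℕ :=
  Nat.card (SYT (Sh 1 (singleRow k) n))

/-! The largest entry of a tableau sits at a corner, and deleting it leaves a tableau of the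
remaining shape, so the count is a sum over corners (`card_SYT_eq_sum_corners`). Starting from full
rows of six cells, the only shapes that arise are full rows followed by strictly decreasing rows of
lengths below 6: a number of full rows together with one of the 32 subsets of {1, …, 5}
(`sixCount_succ`).

Six successive deletions preserve the class of the six subsets with sum divisible by 6. This gives a
system v(m + 1) = A v(m) with a 6 × 6 matrix A, where T(·, 6) is the first coordinate of v
(`sixCount_system`). The row vector u = (-1, 1, -1, 1, 2, -1) satisfies u A = 0. If p is the quintic
attached to the recurrence and e₁ the first unit row vector, then e₁ p(A) = 32 u, hence e₁ p(A) A =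
0, which is the recurrence. -/

/-! ### Deleting the largest entry of a tableau. -/

theorem SYT.ext_entry {S : Finset (ℤ × ℤ)} {s t : SYT S} (h : s.entry = t.entry) : s = t := by
  cases s; cases t; cases h; rfl

instance SYT.finite (S : Finset (ℤ × ℤ)) : Finite (SYT S) := by
  have hinj : Function.Injective fun (t : SYT S) (u : {u : ℤ × ℤ // u ∈ S}) =>
      (⟨t.entry u, t.mem_Icc u⟩ : {k // k ∈ Finset.Icc 1 S.card}) := by
    intro s t h
    refine SYT.ext_entry (funext fun u => ?_)
    exact congrArg Subtype.val (congrFun h u)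
  exact Finite.of_injective _ hinj

theorem SYT.exists_entry_eq_card {S : Finset (ℤ × ℤ)} (hS : S.Nonempty) (t : SYT S) :
    ∃ u, t.entry u = S.card := by
  have himg : Finset.univ.image t.entry = Finset.Icc 1 S.card := by
    refine Finset.eq_of_subset_of_card_le ?_ ?_
    · intro k hk
      obtain ⟨u, -, rfl⟩ := Finset.mem_image.1 hk
      exact t.mem_Icc u
    · rw [Finset.card_image_of_injective _ t.injective]
      simp
  have : S.card ∈ Finset.univ.image t.entry := by
    rw [himg, Finset.mem_Icc]
    exact ⟨hS.card_pos, le_rfl⟩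
  obtain ⟨u, -, hu⟩ := Finset.mem_image.1 this
  exact ⟨u, hu⟩

/-- A cell is a corner of `S` if `S` contains neither its right nor its lower neighbour. -/
def IsCornerCell (S : Finset (ℤ × ℤ)) (c : ℤ × ℤ) : Prop :=
  (c.1, c.2 + 1) ∉ S ∧ (c.1 + 1, c.2) ∉ S

theorem SYT.isCorner_of_entry_eq_card {S : Finset (ℤ × ℤ)} (t : SYT S)
    {c : {u : ℤ × ℤ // u ∈ S}} (hc : t.entry c = S.card) : IsCornerCell S c := by
  obtain ⟨⟨i, j⟩, hij⟩ := c
  refine ⟨fun h => ?_, fun h => ?_⟩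
  · have h1 := t.row_lt i j hij h
    have h2 := (Finset.mem_Icc.1 (t.mem_Icc ⟨(i, j + 1), h⟩)).2
    omega
  · have h1 := t.col_lt i j hij h
    have h2 := (Finset.mem_Icc.1 (t.mem_Icc ⟨(i + 1, j), h⟩)).2
    omega

/-- Removing the largest entry of a tableau. -/
def SYT.eraseTop {S : Finset (ℤ × ℤ)} (c : {u : ℤ × ℤ // u ∈ S}) (t : SYT S)
    (hc : t.entry c = S.card) : SYT (S.erase c) where
  entry u := t.entry ⟨u, Finset.mem_of_mem_erase u.2⟩
  injective u v h := by
    have := t.injective h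
    exact Subtype.ext (congrArg (fun w => w.1) this)
  mem_Icc u := by
    have h1 := Finset.mem_Icc.1 (t.mem_Icc ⟨u, Finset.mem_of_mem_erase u.2⟩)
    have h2 : t.entry ⟨u, Finset.mem_of_mem_erase u.2⟩ ≠ S.card := by
      rw [← hc]
      intro h
      exact Finset.ne_of_mem_erase u.2 (congrArg Subtype.val (t.injective h))
    rw [Finset.card_erase_of_mem c.2, Finset.mem_Icc]
    omega
  row_lt i j _ _ := t.row_lt i j _ _
  col_lt i j _ _ := t.col_lt i j _ _

/-- Adding the largest entry of a tableau at a corner. -/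
def SYT.insertTop {S : Finset (ℤ × ℤ)} (c : {u : ℤ × ℤ // u ∈ S}) (hc : IsCornerCell S c)
    (t : SYT (S.erase c)) : SYT S where
  entry u := if h : u.1 = c.1 then S.card else t.entry ⟨u, Finset.mem_erase.2 ⟨h, u.2⟩⟩
  injective u v h := by
    have hlt : ∀ w, t.entry w < S.card := fun w => by
      have h1 := Finset.mem_Icc.1 (t.mem_Icc w)
      rw [Finset.card_erase_of_mem c.2] at h1
      omega
    by_cases hu : u.1 = c.1 <;> by_cases hv : v.1 = c.1
    · exact Subtype.ext (hu.trans hv.symm)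
    · simp only [hu, hv, dite_true, dite_false] at h
      exact absurd h (hlt _).ne'
    · simp only [hu, hv, dite_true, dite_false] at h
      exact absurd h (hlt _).ne
    · simp only [hu, hv, dite_false] at h
      exact Subtype.ext (congrArg (fun w => w.1) (t.injective h))
  mem_Icc u := by
    have hpos : 0 < S.card := Finset.card_pos.2 ⟨c.1, c.2⟩
    split_ifs with h
    · exact Finset.mem_Icc.2 ⟨hpos, le_rfl⟩
    · have h1 := Finset.mem_Icc.1 (t.mem_Icc ⟨u, Finset.mem_erase.2 ⟨h, u.2⟩⟩)
      rw [Finset.card_erase_of_mem c.2] at h1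
      rw [Finset.mem_Icc]
      omega
  row_lt i j h h' := by
    have hne : (i, j) ≠ c.1 := fun e => hc.1 (by rw [← e]; exact h')
    by_cases hv : (i, j + 1) = c.1
    · simp only [hne, hv, dite_true, dite_false]
      have h1 := Finset.mem_Icc.1 (t.mem_Icc ⟨(i, j), Finset.mem_erase.2 ⟨hne, h⟩⟩)
      rw [Finset.card_erase_of_mem c.2] at h1
      omega
    · simp only [hne, hv, dite_false]
      exact t.row_lt i j _ _
  col_lt i j h h' := by
    have hne : (i, j) ≠ c.1 := fun e => hc.2 (by rw [← e]; exact h')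
    by_cases hv : (i + 1, j) = c.1
    · simp only [hne, hv, dite_true, dite_false]
      have h1 := Finset.mem_Icc.1 (t.mem_Icc ⟨(i, j), Finset.mem_erase.2 ⟨hne, h⟩⟩)
      rw [Finset.card_erase_of_mem c.2] at h1
      omega
    · simp only [hne, hv, dite_false]
      exact t.col_lt i j _ _

/-- Tableaux with their largest entry at a given corner correspond to tableaux without it. -/
def SYT.eraseTopEquiv {S : Finset (ℤ × ℤ)} (c : {u : ℤ × ℤ // u ∈ S}) (hc : IsCornerCell S c) :
    {t : SYT S // t.entry c = S.card} ≃ SYT (S.erase c) where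
  toFun t := t.1.eraseTop c t.2
  invFun t := ⟨t.insertTop c hc, by simp [SYT.insertTop]⟩
  left_inv t := by
    refine Subtype.ext (SYT.ext_entry (funext fun u => ?_))
    by_cases h : u.1 = c.1
    · have : u = c := Subtype.ext h
      subst this
      simp [SYT.insertTop, t.2]
    · exact dif_neg h
  right_inv t := by
    refine SYT.ext_entry (funext fun u => ?_)
    exact dif_neg (Finset.ne_of_mem_erase u.2)

open Classical in
theorem card_SYT_eq_sum_corners {S : Finset (ℤ × ℤ)} (hS : S.Nonempty) :
    Nat.card (SYT S) = ∑ c ∈ S, if IsCornerCell S c then Nat.card (SYT (S.erase c)) else 0 := by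
  choose top htop using fun t : SYT S => t.exists_entry_eq_card hS
  have hfib : ∀ c : {u : ℤ × ℤ // u ∈ S}, Nat.card {t : SYT S // top t = c} =
      if IsCornerCell S c then Nat.card (SYT (S.erase c)) else 0 := by
    intro c
    have hiff : ∀ t : SYT S, top t = c ↔ t.entry c = S.card := fun t =>
      ⟨fun h => h ▸ htop t, fun h => t.injective ((htop t).trans h.symm)⟩
    rw [Nat.card_congr (Equiv.subtypeEquivRight hiff)]
    split_ifs with hc
    · exact Nat.card_congr (SYT.eraseTopEquiv c hc)
    · have : IsEmpty {t : SYT S // t.entry c = S.card} :=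
        ⟨fun t => hc (t.1.isCorner_of_entry_eq_card t.2)⟩
      exact Nat.card_of_isEmpty
  rw [← Nat.card_congr (Equiv.sigmaFiberEquiv top), Nat.card_sigma, Finset.sum_congr rfl
    fun c _ => hfib c]
  exact Finset.sum_coe_sort S fun c => if IsCornerCell S c then Nat.card (SYT (S.erase c)) else 0

/-! ### Corners of slanted shapes. -/

/-- The shape whose `i`-th row, for `i < n`, consists of `a i` consecutive cells, every row starting
one column to the right of the row above it. -/
def slantedShape (n : ℕ) (a : ℕ → ℕ) : Finset (ℤ × ℤ) :=
  ((Finset.range n).sigma fun i => Finset.range (a i)).image fun p =>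
    ((p.1 : ℤ) + 1, (p.1 : ℤ) + (p.2 : ℤ) + 1)

theorem mem_slantedShape {n : ℕ} {a : ℕ → ℕ} {x y : ℤ} :
    (x, y) ∈ slantedShape n a ↔ ∃ i < n, ∃ j < a i, x = (i : ℤ) + 1 ∧ y = (i : ℤ) + (j : ℤ)
      + 1 := by
  simp only [slantedShape, Finset.mem_image, Finset.mem_sigma, Finset.mem_range, Prod.mk.injEq,
    Sigma.exists]
  constructor
  · rintro ⟨i, j, ⟨hi, hj⟩, rfl, rfl⟩
    exact ⟨i, hi, j, hj, rfl, rfl⟩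
  · rintro ⟨i, hi, j, hj, rfl, rfl⟩
    exact ⟨i, j, ⟨hi, hj⟩, rfl, rfl⟩

theorem natCast_mem_slantedShape {n : ℕ} {a : ℕ → ℕ} {i j : ℕ} :
    ((i : ℤ) + 1, (i : ℤ) + (j : ℤ) + 1) ∈ slantedShape n a ↔ i < n ∧ j < a i := by
  rw [mem_slantedShape]
  constructor
  · rintro ⟨i', hi, j', hj, h1, h2⟩
    obtain rfl : i = i' := by omega
    obtain rfl : j = j' := by omega
    exact ⟨hi, hj⟩
  · rintro ⟨hi, hj⟩
    exact ⟨i, hi, j, hj, rfl, rfl⟩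

/-- Because of the shift, position `j` of row `i` lies above position `j - 1` of row `i + 1`.
Position 0 therefore never has a cell below it, which accounts for the case `a i = 1`. The
assumption `a n = 0` lets the bottom row obey the same criterion. -/
theorem isCornerCell_slantedShape {n : ℕ} {a : ℕ → ℕ} (ha : a n = 0) {i j : ℕ} (hi : i < n)
    (hj : j < a i) :
    IsCornerCell (slantedShape n a) ((i : ℤ) + 1, (i : ℤ) + (j : ℤ) + 1) ↔
      j + 1 = a i ∧ (a i = 1 ∨ a (i + 1) + 1 < a i) := by
  have hright : ((i : ℤ) + 1, (i : ℤ) + (j : ℤ) + 1 + 1) ∈ slantedShape n a ↔ j + 1 < a i := by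
    have := natCast_mem_slantedShape (n := n) (a := a) (i := i) (j := j + 1)
    push_cast at this
    rw [← add_assoc] at this
    rw [this]
    simp [hi]
  have hbelow : ((i : ℤ) + 1 + 1, (i : ℤ) + (j : ℤ) + 1) ∈ slantedShape n a ↔
      0 < j ∧ j ≤ a (i + 1) := by
    rw [mem_slantedShape]
    constructor
    · rintro ⟨i', hi', j', hj', h1, h2⟩
      obtain rfl : i' = i + 1 := by omega
      push_cast at h2
      omega
    · rintro ⟨h1, h2⟩
      refine ⟨i + 1, ?_, j - 1, by omega, by push_cast; ring, by omega⟩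
      rcases Nat.lt_or_ge (i + 1) n with h | h
      · exact h
      · obtain rfl : n = i + 1 := by omega
        omega
  simp only [IsCornerCell, hright, hbelow]
  omega

theorem slantedShape_erase {n : ℕ} {a : ℕ → ℕ} {i j : ℕ} (hj : j + 1 = a i) :
    (slantedShape n a).erase ((i : ℤ) + 1, (i : ℤ) + (j : ℤ) + 1) =
      slantedShape n (Function.update a i (a i - 1)) := by
  ext ⟨x, y⟩
  rw [Finset.mem_erase, mem_slantedShape, mem_slantedShape]
  constructor
  · rintro ⟨hne, i', hi', j', hj', rfl, rfl⟩
    refine ⟨i', hi', j', ?_, rfl, rfl⟩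
    rcases eq_or_ne i' i with rfl | h
    · have : j' ≠ j := fun h => hne (by rw [h])
      rw [Function.update_self]
      omega
    · rwa [Function.update_of_ne h]
  · rintro ⟨i', hi', j', hj', rfl, rfl⟩
    rcases eq_or_ne i' i with rfl | h
    · rw [Function.update_self] at hj'
      refine ⟨fun h => ?_, i', hi', j', by omega, rfl, rfl⟩
      have := (Prod.mk.inj h).2
      omega
    · rw [Function.update_of_ne h] at hj'
      refine ⟨fun h' => h ?_, i', hi', j', hj', rfl, rfl⟩
      have := (Prod.mk.inj h').1
      omega

/-- The number of tableaux of a slanted shape satisfies a recursion over the rows whose last cell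
is a corner. -/
theorem card_SYT_slantedShape {n : ℕ} {a : ℕ → ℕ} (ha : a n = 0) (hpos : ∃ i < n, 0 < a i) :
    Nat.card (SYT (slantedShape n a)) = ∑ i ∈ Finset.range n,
      if a i = 1 ∨ a (i + 1) + 1 < a i then
        Nat.card (SYT (slantedShape n (Function.update a i (a i - 1)))) else 0 := by
  classical
  have hne : (slantedShape n a).Nonempty := by
    obtain ⟨i, hi, hi'⟩ := hpos
    exact ⟨_, natCast_mem_slantedShape.2 ⟨hi, hi'⟩⟩
  rw [card_SYT_eq_sum_corners hne]
  conv_lhs => rw [slantedShape]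
  rw [Finset.sum_image, Finset.sum_sigma]
  · refine Finset.sum_congr rfl fun i hi => ?_
    rw [Finset.mem_range] at hi
    have hterm : ∀ j ∈ Finset.range (a i),
        (if IsCornerCell (slantedShape n a) ((i : ℤ) + 1, (i : ℤ) + (j : ℤ) + 1) then
          Nat.card (SYT ((slantedShape n a).erase ((i : ℤ) + 1, (i : ℤ) + (j : ℤ) + 1))) else 0) =
        if j + 1 = a i then (if a i = 1 ∨ a (i + 1) + 1 < a i then
          Nat.card (SYT (slantedShape n (Function.update a i (a i - 1)))) else 0) else 0 := by
      intro j hj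
      rw [Finset.mem_range] at hj
      by_cases h : j + 1 = a i
      · rw [slantedShape_erase h]
        simp only [isCornerCell_slantedShape ha hi hj, h, true_and, if_true]
      · simp only [isCornerCell_slantedShape ha hi hj, h, false_and, if_false]
    refine (Finset.sum_congr rfl hterm).trans ?_
    rcases Nat.eq_zero_or_pos (a i) with h | h
    · simp [h]
    · rw [Finset.sum_eq_single_of_mem (a i - 1) (Finset.mem_range.2 (by omega))]
      · rw [if_pos (by omega)]
      · intro j _ hj
        rw [if_neg (by omega)]
  · rintro ⟨i, j⟩ _ ⟨i', j'⟩ _ h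
    have h1 := (Prod.mk.inj h).1
    have h2 := (Prod.mk.inj h).2
    obtain rfl : i = i' := by simpa using h1
    obtain rfl : j = j' := by simpa using h2
    rfl

/-- Empty rows contribute no cells, so a shape may be padded with them or stripped of them. -/
theorem slantedShape_congr {n n' : ℕ} {a b : ℕ → ℕ}
    (h : ∀ i, (if i < n then a i else 0) = if i < n' then b i else 0) :
    slantedShape n a = slantedShape n' b := by
  ext ⟨x, y⟩
  have key : ∀ i j, (i < n ∧ j < a i) ↔ (i < n' ∧ j < b i) := by
    intro i j
    have := h i
    split_ifs at this <;> omega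
  simp only [mem_slantedShape]
  constructor
  · rintro ⟨i, hi, j, hj, h'⟩
    exact ⟨i, ((key i j).1 ⟨hi, hj⟩).1, j, ((key i j).1 ⟨hi, hj⟩).2, h'⟩
  · rintro ⟨i, hi, j, hj, h'⟩
    exact ⟨i, ((key i j).2 ⟨hi, hj⟩).1, j, ((key i j).2 ⟨hi, hj⟩).2, h'⟩

/-- The top and bottom rows of a one-row period coincide, so the two left-most cells cancel. -/
theorem shiftVector_singleRow {k : ℕ} (hk : 0 < k) : shiftVector (singleRow k) 1 = (1, 1) := by
  have hmem : ∀ i j : ℤ, (i, j) ∈ singleRow k ↔ i = 1 ∧ 1 ≤ j ∧ j ≤ k := by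
    intro i j
    simp only [singleRow, Finset.mem_image, Finset.mem_Icc, Prod.mk.injEq]
    constructor
    · rintro ⟨j', hj, rfl, rfl⟩
      exact ⟨rfl, hj⟩
    · rintro ⟨rfl, hj⟩
      exact ⟨j, hj, rfl, rfl⟩
  have hrows : {i : ℤ | ∃ j : ℤ, (i, j) ∈ singleRow k} = {1} := by
    ext i
    simp only [hmem, Set.mem_ofPred_eq, Set.mem_singleton_iff]
    exact ⟨fun ⟨_, h⟩ => h.1, fun h => ⟨1, h, le_rfl, by exact_mod_cast hk⟩⟩
  simp [shiftVector, topRow, bottomRow, hrows]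

theorem Sh_singleRow (n : ℕ) {k : ℕ} (hk : 0 < k) :
    Sh 1 (singleRow k) n = slantedShape n fun _ => k := by
  ext ⟨x, y⟩
  simp only [Sh, shiftVector_singleRow hk]
  simp only [mem_slantedShape, Finset.mem_biUnion, Finset.mem_image,
    Finset.mem_range, singleRow, Finset.mem_Icc]
  constructor
  · rintro ⟨i, hi, u, ⟨j, hj, rfl⟩, h⟩
    simp at h
    exact ⟨i, hi, (j - 1).toNat, by omega, by omega, by omega⟩
  · rintro ⟨i, hi, j, hj, rfl, rfl⟩
    refine ⟨i, hi, _, ⟨(j : ℤ) + 1, by omega, rfl⟩, ?_⟩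
    simp [add_assoc]

/-! ### Full rows of length 6 followed by a short tail. -/

/-- Row lengths: `m` rows of length `6` followed by rows of lengths `a`, `b`, `c`, `d`, `e`. -/
def sixRows (m a b c d e : ℕ) (i : ℕ) : ℕ :=
  if i < m then 6 else [a, b, c, d, e].getD (i - m) 0

/-- The number of tableaux of the slanted shape with `m` rows of length `6` followed by rows of
lengths `a`, `b`, `c`, `d`, `e`. -/
noncomputable def sixCount (m a b c d e : ℕ) : ℕ :=
  Nat.card (SYT (slantedShape (m + 5) (sixRows m a b c d e)))

theorem T_six_eq_sixCount (n : ℕ) : T n 6 = sixCount n 0 0 0 0 0 := by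
  rw [T, Sh_singleRow n (by norm_num), sixCount]
  congr 2
  refine slantedShape_congr fun i => ?_
  rw [sixRows]
  by_cases hi : i < n
  · simp [hi, show i < n + 5 by omega]
  · rcases i - n with _ | _ | _ | _ | _ | k <;> simp [hi]

theorem sixRows_of_lt {m a b c d e i : ℕ} (h : i < m) : sixRows m a b c d e i = 6 :=
  if_pos h

theorem sixRows_add (m a b c d e i : ℕ) :
    sixRows m a b c d e (m + i) = [a, b, c, d, e].getD i 0 := by
  simp [sixRows]

theorem slantedShape_sixRows_eq {m a b c d e a' b' c' d' e' k v : ℕ}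
    (h : ∀ i, Function.update (fun i => [a, b, c, d, e].getD i 0) k v i =
      [a', b', c', d', e'].getD i 0) :
    slantedShape (m + 5) (Function.update (sixRows m a b c d e) (m + k) v) =
      slantedShape (m + 5) (sixRows m a' b' c' d' e') := by
  congr 1
  funext i
  rcases Nat.lt_or_ge i m with hi | hi
  · rw [Function.update_of_ne (by omega), sixRows_of_lt hi, sixRows_of_lt hi]
  · obtain ⟨i, rfl⟩ := Nat.exists_eq_add_of_le hi
    rw [sixRows_add, ← h i]
    rcases eq_or_ne i k with rfl | hik
    · simp
    · rw [Function.update_of_ne (by omega), Function.update_of_ne hik, sixRows_add]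

/-- A full row that loses its last cell becomes the first row of the tail. The tail still has at
most five rows since its fifth length was 0. -/
theorem slantedShape_sixRows_full (m a b c d : ℕ) :
    slantedShape (m + 1 + 5) (Function.update (sixRows (m + 1) a b c d 0) m 5) =
      slantedShape (m + 5) (sixRows m 5 a b c d) := by
  refine slantedShape_congr fun i => ?_
  rcases Nat.lt_or_ge i m with hi | hi
  · rw [Function.update_of_ne (by omega), sixRows_of_lt hi, sixRows_of_lt (by omega),
      if_pos (by omega), if_pos (by omega)]
  · obtain ⟨i, rfl⟩ := Nat.exists_eq_add_of_le hi
    rw [sixRows_add]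
    rcases i with _ | i
    · simp [show m < m + 1 + 5 by omega]
    · rw [Function.update_of_ne (by omega), show m + (i + 1) = m + 1 + i by ring, sixRows_add]
      rcases i with _ | _ | _ | _ | _ | i <;> simp [add_assoc]

/-- The recursion for `sixCount` over the possible positions of the largest entry. -/
theorem sixCount_succ (m a b c d e : ℕ) (h : a = 5 ∨ a < 5 ∧ e = 0) :
    sixCount (m + 1) a b c d e =
      (if a < 5 then sixCount m 5 a b c d else 0) +
      (if a = 1 ∨ b + 1 < a then sixCount (m + 1) (a - 1) b c d e else 0) +
      (if b = 1 ∨ c + 1 < b then sixCount (m + 1) a (b - 1) c d e else 0) +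
      (if c = 1 ∨ d + 1 < c then sixCount (m + 1) a b (c - 1) d e else 0) +
      (if d = 1 ∨ e + 1 < d then sixCount (m + 1) a b c (d - 1) e else 0) +
      (if e = 1 ∨ 1 < e then sixCount (m + 1) a b c d (e - 1) else 0) := by
  have hr := sixRows_add (m + 1) a b c d e
  have h0 := hr 0
  have h1 := hr 1
  have h2 := hr 2
  have h3 := hr 3
  have h4 := hr 4
  have h5 := hr 5
  have hm : sixRows (m + 1) a b c d e m = 6 := sixRows_of_lt (by omega)
  simp only [List.getD_cons_zero, List.getD_cons_succ, List.getD_nil, add_zero] at h0 h1 h2 h3 h4 h5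
  unfold sixCount
  rw [card_SYT_slantedShape h5 ⟨m, by omega, by omega⟩]
  rw [Finset.sum_range_succ, Finset.sum_range_succ, Finset.sum_range_succ, Finset.sum_range_succ,
    Finset.sum_range_succ, Finset.sum_range_succ, Finset.sum_eq_zero, zero_add]
  · rw [h0, h1, h2, h3, h4, h5, hm]
    refine congrArg₂ _ (congrArg₂ _ (congrArg₂ _ (congrArg₂ _ (congrArg₂ _ ?_ ?_) ?_) ?_) ?_) ?_
    -- The last full row ends in a corner exactly when `a + 1 < 6`.
    · rcases h with rfl | ⟨ha, rfl⟩
      · simp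
      · rw [if_pos ha, if_pos (by omega), ← slantedShape_sixRows_full]
    · refine if_congr Iff.rfl (congrArg (fun s => Nat.card (SYT s))
        (slantedShape_sixRows_eq (k := 0) ?_)) rfl
      rintro (_ | _ | _ | _ | _ | i) <;> simp
    · refine if_congr Iff.rfl (congrArg (fun s => Nat.card (SYT s))
        (slantedShape_sixRows_eq (k := 1) ?_)) rfl
      rintro (_ | _ | _ | _ | _ | i) <;> simp
    · refine if_congr Iff.rfl (congrArg (fun s => Nat.card (SYT s))
        (slantedShape_sixRows_eq (k := 2) ?_)) rfl
      rintro (_ | _ | _ | _ | _ | i) <;> simp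
    · refine if_congr Iff.rfl (congrArg (fun s => Nat.card (SYT s))
        (slantedShape_sixRows_eq (k := 3) ?_)) rfl
      rintro (_ | _ | _ | _ | _ | i) <;> simp
    · refine if_congr (by omega) (congrArg (fun s => Nat.card (SYT s))
        (slantedShape_sixRows_eq (k := 4) ?_)) rfl
      rintro (_ | _ | _ | _ | _ | i) <;> simp
  -- A full row above another full row has no corner: `6 + 1 < 6` fails.
  · intro i hi
    rw [Finset.mem_range] at hi
    rw [sixRows_of_lt (by omega), sixRows_of_lt (by omega)]
    simp

/-! ### The transfer system for six deletions. -/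

/-- The numbers of tableaux of the six slanted shapes whose size is divisible by `6` satisfy a
linear system of recurrences. -/
theorem sixCount_system (m : ℕ) :
    sixCount (m + 4) 0 0 0 0 0 =
      sixCount (m + 3) 0 0 0 0 0 + 4 * sixCount (m + 2) 5 1 0 0 0 + 5 * sixCount (m + 2) 4 2
        0 0 0 + 2 * sixCount (m + 1) 5 4 3 0 0 ∧
    sixCount (m + 3) 5 1 0 0 0 =
      4 * sixCount (m + 3) 0 0 0 0 0 + 19 * sixCount (m + 2) 5 1 0 0 0 + 30 * sixCount (m +
        2) 4 2 0 0 0 + 5 * sixCount (m + 2) 3 2 1 0 0 + 12 * sixCount (m + 1) 5 4 3 0 0 + 7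
        * sixCount (m + 1) 5 4 2 1 0 ∧
    sixCount (m + 3) 4 2 0 0 0 =
      5 * sixCount (m + 3) 0 0 0 0 0 + 30 * sixCount (m + 2) 5 1 0 0 0 + 61 * sixCount (m +
        2) 4 2 0 0 0 + 16 * sixCount (m + 2) 3 2 1 0 0 + 30 * sixCount (m + 1) 5 4 3 0 0 +
        26 * sixCount (m + 1) 5 4 2 1 0 ∧
    sixCount (m + 3) 3 2 1 0 0 =
      2 * sixCount (m + 3) 0 0 0 0 0 + 12 * sixCount (m + 2) 5 1 0 0 0 + 30 * sixCount (m +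
        2) 4 2 0 0 0 + 10 * sixCount (m + 2) 3 2 1 0 0 + 20 * sixCount (m + 1) 5 4 3 0 0 +
        20 * sixCount (m + 1) 5 4 2 1 0 ∧
    sixCount (m + 2) 5 4 3 0 0 =
      5 * sixCount (m + 2) 5 1 0 0 0 + 16 * sixCount (m + 2) 4 2 0 0 0 + 5 * sixCount (m +
        2) 3 2 1 0 0 + 10 * sixCount (m + 1) 5 4 3 0 0 + 9 * sixCount (m + 1) 5 4 2 1 0 ∧
    sixCount (m + 2) 5 4 2 1 0 =
      7 * sixCount (m + 2) 5 1 0 0 0 + 26 * sixCount (m + 2) 4 2 0 0 0 + 9 * sixCount (m +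
        2) 3 2 1 0 0 + 20 * sixCount (m + 1) 5 4 3 0 0 + 19 * sixCount (m + 1) 5 4 2 1 0 :=
        by
  -- One equation for each of the 32 tails, whose lengths are the digits in the name (`h0` is the
  -- empty tail), grouped by size modulo 6. The numbers of full rows are chosen so that substitution
  -- stops after six deletions.
  have h0 : sixCount (m + 4) 0 0 0 0 0 =
      sixCount (m + 3) 5 0 0 0 0 :=
    (sixCount_succ (m + 3) 0 0 0 0 0 (by norm_num)).trans (by norm_num)
  have h51 : sixCount (m + 3) 5 1 0 0 0 =
      sixCount (m + 3) 4 1 0 0 0 + sixCount (m + 3) 5 0 0 0 0 :=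
    (sixCount_succ (m + 2) 5 1 0 0 0 (by norm_num)).trans (by norm_num)
  have h42 : sixCount (m + 3) 4 2 0 0 0 =
      sixCount (m + 2) 5 4 2 0 0 + sixCount (m + 3) 3 2 0 0 0 + sixCount (m + 3) 4 1 0 0 0 :=
    (sixCount_succ (m + 2) 4 2 0 0 0 (by norm_num)).trans (by norm_num)
  have h321 : sixCount (m + 3) 3 2 1 0 0 =
      sixCount (m + 2) 5 3 2 1 0 + sixCount (m + 3) 3 2 0 0 0 :=
    (sixCount_succ (m + 2) 3 2 1 0 0 (by norm_num)).trans (by norm_num)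
  have h543 : sixCount (m + 2) 5 4 3 0 0 =
      sixCount (m + 2) 5 4 2 0 0 :=
    (sixCount_succ (m + 1) 5 4 3 0 0 (by norm_num)).trans (by norm_num)
  have h5421 : sixCount (m + 2) 5 4 2 1 0 =
      sixCount (m + 2) 5 3 2 1 0 + sixCount (m + 2) 5 4 2 0 0 :=
    (sixCount_succ (m + 1) 5 4 2 1 0 (by norm_num)).trans (by norm_num)
  have h5 : sixCount (m + 3) 5 0 0 0 0 =
      sixCount (m + 3) 4 0 0 0 0 :=
    (sixCount_succ (m + 2) 5 0 0 0 0 (by norm_num)).trans (by norm_num)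
  have h41 : sixCount (m + 3) 4 1 0 0 0 =
      sixCount (m + 2) 5 4 1 0 0 + sixCount (m + 3) 3 1 0 0 0 + sixCount (m + 3) 4 0 0 0 0 :=
    (sixCount_succ (m + 2) 4 1 0 0 0 (by norm_num)).trans (by norm_num)
  have h542 : sixCount (m + 2) 5 4 2 0 0 =
      sixCount (m + 2) 5 3 2 0 0 + sixCount (m + 2) 5 4 1 0 0 :=
    (sixCount_succ (m + 1) 5 4 2 0 0 (by norm_num)).trans (by norm_num)
  have h32 : sixCount (m + 3) 3 2 0 0 0 =
      sixCount (m + 2) 5 3 2 0 0 + sixCount (m + 3) 3 1 0 0 0 :=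
    (sixCount_succ (m + 2) 3 2 0 0 0 (by norm_num)).trans (by norm_num)
  have h5321 : sixCount (m + 2) 5 3 2 1 0 =
      sixCount (m + 2) 4 3 2 1 0 + sixCount (m + 2) 5 3 2 0 0 :=
    (sixCount_succ (m + 1) 5 3 2 1 0 (by norm_num)).trans (by norm_num)
  have h4 : sixCount (m + 3) 4 0 0 0 0 =
      sixCount (m + 2) 5 4 0 0 0 + sixCount (m + 3) 3 0 0 0 0 :=
    (sixCount_succ (m + 2) 4 0 0 0 0 (by norm_num)).trans (by norm_num)
  have h541 : sixCount (m + 2) 5 4 1 0 0 =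
      sixCount (m + 2) 5 3 1 0 0 + sixCount (m + 2) 5 4 0 0 0 :=
    (sixCount_succ (m + 1) 5 4 1 0 0 (by norm_num)).trans (by norm_num)
  have h31 : sixCount (m + 3) 3 1 0 0 0 =
      sixCount (m + 2) 5 3 1 0 0 + sixCount (m + 3) 2 1 0 0 0 + sixCount (m + 3) 3 0 0 0 0 :=
    (sixCount_succ (m + 2) 3 1 0 0 0 (by norm_num)).trans (by norm_num)
  have h532 : sixCount (m + 2) 5 3 2 0 0 =
      sixCount (m + 2) 4 3 2 0 0 + sixCount (m + 2) 5 3 1 0 0 :=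
    (sixCount_succ (m + 1) 5 3 2 0 0 (by norm_num)).trans (by norm_num)
  have h4321 : sixCount (m + 2) 4 3 2 1 0 =
      sixCount (m + 1) 5 4 3 2 1 + sixCount (m + 2) 4 3 2 0 0 :=
    (sixCount_succ (m + 1) 4 3 2 1 0 (by norm_num)).trans (by norm_num)
  have h54 : sixCount (m + 2) 5 4 0 0 0 =
      sixCount (m + 2) 5 3 0 0 0 :=
    (sixCount_succ (m + 1) 5 4 0 0 0 (by norm_num)).trans (by norm_num)
  have h3 : sixCount (m + 3) 3 0 0 0 0 =
      sixCount (m + 2) 5 3 0 0 0 + sixCount (m + 3) 2 0 0 0 0 :=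
    (sixCount_succ (m + 2) 3 0 0 0 0 (by norm_num)).trans (by norm_num)
  have h531 : sixCount (m + 2) 5 3 1 0 0 =
      sixCount (m + 2) 4 3 1 0 0 + sixCount (m + 2) 5 2 1 0 0 + sixCount (m + 2) 5 3 0 0 0 :=
    (sixCount_succ (m + 1) 5 3 1 0 0 (by norm_num)).trans (by norm_num)
  have h21 : sixCount (m + 3) 2 1 0 0 0 =
      sixCount (m + 2) 5 2 1 0 0 + sixCount (m + 3) 2 0 0 0 0 :=
    (sixCount_succ (m + 2) 2 1 0 0 0 (by norm_num)).trans (by norm_num)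
  have h432 : sixCount (m + 2) 4 3 2 0 0 =
      sixCount (m + 1) 5 4 3 2 0 + sixCount (m + 2) 4 3 1 0 0 :=
    (sixCount_succ (m + 1) 4 3 2 0 0 (by norm_num)).trans (by norm_num)
  have h54321 : sixCount (m + 1) 5 4 3 2 1 =
      sixCount (m + 1) 5 4 3 2 0 :=
    (sixCount_succ (m) 5 4 3 2 1 (by norm_num)).trans (by norm_num)
  have h53 : sixCount (m + 2) 5 3 0 0 0 =
      sixCount (m + 2) 4 3 0 0 0 + sixCount (m + 2) 5 2 0 0 0 :=
    (sixCount_succ (m + 1) 5 3 0 0 0 (by norm_num)).trans (by norm_num)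
  have h2 : sixCount (m + 3) 2 0 0 0 0 =
      sixCount (m + 2) 5 2 0 0 0 + sixCount (m + 3) 1 0 0 0 0 :=
    (sixCount_succ (m + 2) 2 0 0 0 0 (by norm_num)).trans (by norm_num)
  have h431 : sixCount (m + 2) 4 3 1 0 0 =
      sixCount (m + 1) 5 4 3 1 0 + sixCount (m + 2) 4 2 1 0 0 + sixCount (m + 2) 4 3 0 0 0 :=
    (sixCount_succ (m + 1) 4 3 1 0 0 (by norm_num)).trans (by norm_num)
  have h521 : sixCount (m + 2) 5 2 1 0 0 =
      sixCount (m + 2) 4 2 1 0 0 + sixCount (m + 2) 5 2 0 0 0 :=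
    (sixCount_succ (m + 1) 5 2 1 0 0 (by norm_num)).trans (by norm_num)
  have h5432 : sixCount (m + 1) 5 4 3 2 0 =
      sixCount (m + 1) 5 4 3 1 0 :=
    (sixCount_succ (m) 5 4 3 2 0 (by norm_num)).trans (by norm_num)
  have h43 : sixCount (m + 2) 4 3 0 0 0 =
      sixCount (m + 1) 5 4 3 0 0 + sixCount (m + 2) 4 2 0 0 0 :=
    (sixCount_succ (m + 1) 4 3 0 0 0 (by norm_num)).trans (by norm_num)
  have h52 : sixCount (m + 2) 5 2 0 0 0 =
      sixCount (m + 2) 4 2 0 0 0 + sixCount (m + 2) 5 1 0 0 0 :=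
    (sixCount_succ (m + 1) 5 2 0 0 0 (by norm_num)).trans (by norm_num)
  have h1 : sixCount (m + 3) 1 0 0 0 0 =
      sixCount (m + 2) 5 1 0 0 0 + sixCount (m + 3) 0 0 0 0 0 :=
    (sixCount_succ (m + 2) 1 0 0 0 0 (by norm_num)).trans (by norm_num)
  have h5431 : sixCount (m + 1) 5 4 3 1 0 =
      sixCount (m + 1) 5 4 2 1 0 + sixCount (m + 1) 5 4 3 0 0 :=
    (sixCount_succ (m) 5 4 3 1 0 (by norm_num)).trans (by norm_num)
  have h421 : sixCount (m + 2) 4 2 1 0 0 =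
      sixCount (m + 1) 5 4 2 1 0 + sixCount (m + 2) 3 2 1 0 0 + sixCount (m + 2) 4 2 0 0 0 :=
    (sixCount_succ (m + 1) 4 2 1 0 0 (by norm_num)).trans (by norm_num)
  refine ⟨?_, ?_, ?_, ?_, ?_, ?_⟩ <;>
    simp only [h0, h51, h42, h321, h543, h5421, h5, h41, h542, h32, h5321, h4, h541, h31,
      h532, h4321,
      h54, h3, h531, h21, h432, h54321, h53, h2, h431, h521, h5432, h43, h52, h1, h5431,
        h421] <;> ring

/-! ### Elimination. -/

theorem T_six_recurrence (m : ℕ) :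
    (T (m + 9) 6 : ℤ) = 120 * (T (m + 8) 6 : ℤ) - 1672 * (T (m + 7) 6 : ℤ)
      + 544 * (T (m + 6) 6 : ℤ) - 6672 * (T (m + 5) 6 : ℤ) + 256 * (T (m + 4) 6 : ℤ) := by
  simp only [T_six_eq_sixCount]
  have h0 := sixCount_system m
  have h1 := sixCount_system (m + 1)
  have h2 := sixCount_system (m + 2)
  have h3 := sixCount_system (m + 3)
  have h4 := sixCount_system (m + 4)
  have h5 := sixCount_system (m + 5)
  zify at h0 h1 h2 h3 h4 h5
  simp only [add_assoc, Nat.reduceAdd] at h0 h1 h2 h3 h4 h5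
  -- The multipliers follow Horner's scheme for e₁ p(A): those of `h5` form e₁, and each later row
  -- vector is the previous one times A plus the next coefficient of p times e₁. Those of `h0` form
  -- 32 u, which A annihilates, so no terms remain.
  linear_combination h5.1 - 119 * h4.1 + 4 * h4.2.1 + 5 * h4.2.2.1 + 2 * h4.2.2.2.2.1 + 1594 * h3.1
    - 240 * h3.2.1 - 138 * h3.2.2.1 + 110 * h3.2.2.2.1 - 20 * h3.2.2.2.2.1 + 176 *
    h3.2.2.2.2.2 - 380 * h2.1 + 128 * h2.2.1 - 92 * h2.2.2.1 - 824 * h2.2.2.2.1 +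
    1688 * h2.2.2.2.2.1 + 96 * h2.2.2.2.2.2 + 4696 * h1.1 - 2624 * h1.2.1 + 1112 *
    h1.2.2.1 + 232 * h1.2.2.2.1 + 336 * h1.2.2.2.2.1 - 960 * h1.2.2.2.2.2 - 32 *
    h0.1 + 32 * h0.2.1 - 32 * h0.2.2.1 + 32 * h0.2.2.2.1 + 64 * h0.2.2.2.2.1 - 32
    * h0.2.2.2.2.2

theorem corollary2 (n : ℕ) (hn : 76 ≤ n) :
    (T n 6 : ℤ) = 120 * (T (n - 1) 6 : ℤ) - 1672 * (T (n - 2) 6 : ℤ) + 544 * (T (n - 3) 6 : ℤ)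
      - 6672 * (T (n - 4) 6 : ℤ) + 256 * (T (n - 5) 6 : ℤ) := by
  -- The lowest term of the eliminated recurrence is `T (m + 4) 6`, so it is available from `n = 9`
  -- on.
  obtain ⟨m, rfl⟩ := Nat.exists_eq_add_of_le' (show 9 ≤ n by omega)
  exact T_six_recurrence m
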